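/- For a topological space $X$, let $\mathcal B_0(X)$ be the set of continuous functions $X\to\mathbb R$ and, for $n\ge 0$, let $\mathcal B_{n+1}(X)$ be the set of functions $g:X\to\mathbb R$ for which there is a sequence $(g_k)_{k\in\mathbb N}$ in $\mathcal B_n(X)$ with $g_k(x)\to g(x)$ for every $x\in X$ (the functions of Baire class $n+1$). Write $\mathcal B_n=\mathcal B_n(\mathbb R)$, and for $f:\mathbb R\to\mathbb R$ let $C_f$ be the composition operator $C_f(g)=f\circ g$. Theorem. Let $n\ge 0$ be an integer and let $f:\mathbb R\to\mathbb R$ be any function. If $C_f$ maps $\mathcal B_n$ into itself, then $C_f$ is automatically continuous with respect to pointwise convergence. That is, $C_f:\mathcal B_n\to\mathcal B_n$ is continuous when $\mathcal B_n$ carries the topology of pointwise convergence; in particular, whenever $(g_k)_{k\in\mathbb N}$ is a sequence in $\mathcal B_n$ converging pointwise on $\mathbb R$ to some $g\in\mathcal B_n$, the sequence $C_f(g_k)=f\circ g_k$ converges pointwise on $\mathbb R$ to $C_f(g)=f\circ g$. -/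

import Mathlib

open Filter Topology

/-- A function `g : X → ℝ` is of Baire class `0` if it is continuous, and of Baire class `n + 1` if it
is the pointwise limit of a sequence of functions of Baire class `n`. -/
def IsBaireClass {X : Type*} [TopologicalSpace X] : ℕ → (X → ℝ) → Prop
  | 0, g => Continuous g
  | n + 1, g => ∃ G : ℕ → X → ℝ, (∀ k, IsBaireClass n (G k)) ∧
      ∀ x, Tendsto (fun k => G k x) atTop (𝓝 (g x))

/-- The space of real valued functions of Baire class `n` on `X`. As a subtype of `X → ℝ`, which
carries the product topology, it has the topology of pointwise convergence. -/
def BaireSpaceOfClass (n : ℕ) (X : Type*) [TopologicalSpace X] : Set (X → ℝ) :=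
  {g | IsBaireClass n g}

/-- The (autonomous, left) composition operator `g ↦ f ∘ g` generated by `f : ℝ → ℝ`. -/
def leftCompOp {X : Type*} (f : ℝ → ℝ) (g : X → ℝ) : X → ℝ := fun x => f (g x)

/-! It suffices that `f` is continuous. For `n = 0` apply `C_f` to the identity. For positive class,
if `f` jumps at `c`, the sets with indicator in the class are closed under disjoint countable unions
(`isBaireClass_indicator_iUnion`). They contain the rays and are closed under complements, so the
π-λ theorem gives every Borel set, contradicting `exists_measurableSet_not_isBaireClass_indicator`.
-/

namespace IsBaireClass

variable {X : Type*} [TopologicalSpace X]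

theorem succ {n : ℕ} {g : X → ℝ} (hg : IsBaireClass n g) : IsBaireClass (n + 1) g :=
  ⟨fun _ => g, fun _ => hg, fun _ => tendsto_const_nhds⟩

theorem mono {m n : ℕ} (hmn : m ≤ n) {g : X → ℝ} (hg : IsBaireClass m g) : IsBaireClass n g := by
  induction hmn with
  | refl => exact hg
  | step _ ih => exact ih.succ

theorem comp₂ {F : ℝ × ℝ → ℝ} (hF : Continuous F) {n : ℕ} {g h : X → ℝ}
    (hg : IsBaireClass n g) (hh : IsBaireClass n h) : IsBaireClass n fun x => F (g x, h x) := by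
  induction n generalizing g h with
  | zero =>
    have hg' : Continuous g := hg
    have hh' : Continuous h := hh
    exact hF.comp (hg'.prodMk hh')
  | succ n ih =>
    obtain ⟨G, hG, hGg⟩ := hg
    obtain ⟨H, hH, hHh⟩ := hh
    exact ⟨fun k x => F (G k x, H k x), fun k => ih (hG k) (hH k),
      fun x => (hF.tendsto _).comp ((hGg x).prodMk_nhds (hHh x))⟩

theorem comp {F : ℝ → ℝ} (hF : Continuous F) {n : ℕ} {g : X → ℝ} (hg : IsBaireClass n g) :
    IsBaireClass n fun x => F (g x) :=
  comp₂ (hF.comp continuous_fst) hg hg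

theorem of_continuous {g : X → ℝ} (hg : Continuous g) (n : ℕ) : IsBaireClass n g :=
  mono (Nat.zero_le n) (show IsBaireClass 0 g from hg)

theorem sum {ι : Type*} {n : ℕ} {g : ι → X → ℝ} (s : Finset ι)
    (hg : ∀ i ∈ s, IsBaireClass n (g i)) : IsBaireClass n fun x => ∑ i ∈ s, g i x := by
  classical
  induction s using Finset.induction_on with
  | empty => simpa using of_continuous (X := X) (continuous_const (y := (0 : ℝ))) n
  | insert a s ha ih =>
    simp only [Finset.sum_insert ha]
    exact comp₂ (F := fun p => p.1 + p.2) (by fun_prop) (hg a (by simp))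
      (ih fun i hi => hg i (by simp [hi]))

/-- Weierstrass M-test for the Baire classes of positive order. -/
theorem tsum {n : ℕ} {g : ℕ → X → ℝ} {b : ℕ → ℝ} (hb : Summable b)
    (hgb : ∀ i x, |g i x| ≤ b i) (hg : ∀ i, IsBaireClass (n + 1) (g i)) :
    IsBaireClass (n + 1) fun x => ∑' i, g i x := by
  choose G hG hlim using hg
  -- Truncating to `[-b i, b i]` fixes `g i` and makes the approximants dominated by `b`.
  let T : ℕ → ℝ → ℝ := fun i y => max (-(b i)) (min (b i) y)
  have hT : ∀ i, Continuous (T i) := fun i => by fun_prop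
  have hTb : ∀ (x : X) i y, |T i y| ≤ b i := fun x i y => by
    have h0 : 0 ≤ b i := (abs_nonneg _).trans (hgb i x)
    exact abs_le.2 ⟨le_max_left _ _, max_le (by linarith) (min_le_left _ _)⟩
  have hTg : ∀ i x, T i (g i x) = g i x := fun i x => by
    have h := abs_le.1 (hgb i x)
    simp only [T, min_eq_right h.2, max_eq_right h.1]
  refine ⟨fun k x => ∑ i ∈ Finset.range k, T i (G i k x),
    fun k => sum _ fun i _ => (hG i k).comp (hT i), fun x => ?_⟩
  have key : Tendsto (fun k => ∑' i, if i < k then T i (G i k x) else 0) atTop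
      (𝓝 (∑' i, g i x)) := by
    refine tendsto_tsum_of_dominated_convergence hb (fun i => ?_) (.of_forall fun k i => ?_)
    · have h : Tendsto (fun k => T i (G i k x)) atTop (𝓝 (g i x)) := by
        have := ((hT i).tendsto (g i x)).comp (hlim i x)
        rwa [hTg] at this
      refine h.congr' ?_
      filter_upwards [eventually_gt_atTop i] with k hk
      rw [if_pos hk]
    · split_ifs
      · exact hTb x i _
      · simpa using (abs_nonneg _).trans (hgb i x)
  refine key.congr fun k => ?_
  rw [tsum_eq_sum (s := Finset.range k) fun i hi => if_neg (by simpa using hi)]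
  exact Finset.sum_congr rfl fun i hi => if_pos (by simpa using hi)

theorem indicator_Ioi (a : ℝ) (n : ℕ) :
    IsBaireClass (n + 1) ((Set.Ioi a).indicator (1 : ℝ → ℝ)) := by
  refine mono (Nat.le_add_left 1 n)
    ⟨fun k x => min 1 (k * max (x - a) 0), fun k => ?_, fun x => ?_⟩
  · exact show Continuous _ by fun_prop
  · by_cases hx : a < x
    · have hpos : 0 < x - a := sub_pos.2 hx
      obtain ⟨N, hN⟩ := exists_nat_gt (1 / (x - a))
      rw [Set.indicator_of_mem (Set.mem_Ioi.2 hx)]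
      refine tendsto_const_nhds.congr' ?_
      filter_upwards [eventually_ge_atTop N] with k hk
      have hk' : 1 / (x - a) ≤ k := hN.le.trans (by exact_mod_cast hk)
      rw [max_eq_left hpos.le, min_eq_left ((div_le_iff₀ hpos).1 hk')]
      rfl
    · rw [Set.indicator_of_notMem (by simpa using hx)]
      refine tendsto_const_nhds.congr fun k => ?_
      simp [max_eq_right (sub_nonpos.2 (not_lt.1 hx))]

end IsBaireClass

/-- Lets a single real parameter code a sequence of reals. -/
theorem exists_measurable_surjective_real (P : Type*) [MeasurableSpace P] [StandardBorelSpace P]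
    [Nonempty P] : ∃ φ : ℝ → P, Measurable φ ∧ Function.Surjective φ := by
  have he := MeasureTheory.measurableEmbedding_embeddingReal P
  obtain ⟨φ, hφ, h⟩ := he.exists_measurable_extend measurable_id fun _ => inferInstance
  exact ⟨φ, hφ, fun p => ⟨_, congrFun h p⟩⟩

theorem tendsto_int_floor_mul_div_natCast (x : ℝ) :
    Tendsto (fun k : ℕ => (⌊x * k⌋ : ℝ) / k) atTop (𝓝 x) := by
  have h : Tendsto (fun k : ℕ => x - 1 / (k : ℝ)) atTop (𝓝 x) := by
    simpa using tendsto_const_nhds.sub (tendsto_one_div_atTop_nhds_zero_nat (𝕜 := ℝ))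
  refine tendsto_of_tendsto_of_tendsto_of_le_of_le' h tendsto_const_nhds ?_ ?_ <;>
    filter_upwards [eventually_gt_atTop 0] with k hk <;>
    have hk' : (0 : ℝ) < k := Nat.cast_pos.2 hk
  · rw [le_div_iff₀ hk', sub_mul, one_div_mul_cancel hk'.ne']
    exact (Int.sub_one_lt_floor _).le
  · exact (div_le_iff₀ hk').2 (Int.floor_le _)

/-- There is a Borel function on the plane having every function of Baire class `n` as a
section. -/
theorem exists_measurable_universal_isBaireClass (n : ℕ) :
    ∃ U : ℝ → ℝ → ℝ, Measurable (Function.uncurry U) ∧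
      ∀ g : ℝ → ℝ, IsBaireClass n g → ∃ t, U t = g := by
  induction n with
  | zero =>
    obtain ⟨φ, hφ, hsurj⟩ := exists_measurable_surjective_real (ℤ → ℕ → ℝ)
    -- `t` codes the samples `g (m / k)`, which determine a continuous `g`. Unlike a limit, `limsup`
    -- is measurable in `(t, x)` without convergence.
    refine ⟨fun t x => limsup (fun k : ℕ => φ t ⌊x * k⌋ k) atTop, ?_, fun g hg => ?_⟩
    · refine Measurable.limsup fun k => ?_
      have hev : Measurable fun q : (ℤ → ℕ → ℝ) × ℤ => q.1 q.2 k :=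
        measurable_from_prod_countable_left fun m => by fun_prop
      exact hev.comp ((hφ.comp measurable_fst).prodMk
        (Int.measurable_floor.comp (measurable_snd.mul_const _)))
    · obtain ⟨t, ht⟩ := hsurj fun m k => g (m / k)
      have hg' : Continuous g := hg
      refine ⟨t, funext fun x => Tendsto.limsup_eq ?_⟩
      simp only [ht]
      refine (hg'.tendsto x).comp ?_
      exact tendsto_int_floor_mul_div_natCast x
  | succ n ih =>
    obtain ⟨U, hU, huniv⟩ := ih
    obtain ⟨φ, hφ, hsurj⟩ := exists_measurable_surjective_real (ℕ → ℝ)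
    refine ⟨fun t x => limsup (fun k : ℕ => U (φ t k) x) atTop, ?_, fun g hg => ?_⟩
    · exact Measurable.limsup fun k =>
        hU.comp (((measurable_pi_apply k).comp (hφ.comp measurable_fst)).prodMk measurable_snd)
    · obtain ⟨G, hG, hlim⟩ := hg
      choose s hs using fun k => huniv (G k) (hG k)
      obtain ⟨t, ht⟩ := hsurj s
      refine ⟨t, funext fun x => Tendsto.limsup_eq ?_⟩
      simpa only [ht, hs] using hlim x

/-- Cantor's diagonal argument on the universal function. -/
theorem exists_measurableSet_not_isBaireClass_indicator (n : ℕ) :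
    ∃ A : Set ℝ, MeasurableSet A ∧ ¬ IsBaireClass n (A.indicator (1 : ℝ → ℝ)) := by
  obtain ⟨U, hU, huniv⟩ := exists_measurable_universal_isBaireClass n
  have hd : Measurable fun t => U t t := hU.comp (measurable_id.prodMk measurable_id)
  refine ⟨{t | U t t = 1}ᶜ, (hd (measurableSet_singleton 1)).compl, fun h => ?_⟩
  obtain ⟨t, ht⟩ := huniv _ h
  have htt := congrFun ht t
  by_cases h1 : U t t = 1
  · rw [Set.indicator_of_notMem (by simpa using h1), h1] at htt
    exact one_ne_zero htt
  · rw [Set.indicator_of_mem (by simpa using h1)] at htt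
    exact h1 htt

/-- If left composition with a function discontinuous at `c` preserved Baire class `n + 1`, the
sets with indicator function of Baire class `n + 1` would be closed under disjoint unions. -/
theorem isBaireClass_indicator_iUnion {n : ℕ} {f : ℝ → ℝ} {c : ℝ}
    (hf : ∀ g : ℝ → ℝ, IsBaireClass (n + 1) g → IsBaireClass (n + 1) fun x => f (g x))
    (hc : ¬ ContinuousAt f c) {A : ℕ → Set ℝ} (hd : Pairwise (Function.onFun Disjoint A))
    (hA : ∀ k, IsBaireClass (n + 1) ((A k).indicator (1 : ℝ → ℝ))) :
    IsBaireClass (n + 1) ((⋃ k, A k).indicator (1 : ℝ → ℝ)) := by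
  rw [Metric.continuousAt_iff] at hc
  push Not at hc
  obtain ⟨ε, hε, hc⟩ := hc
  -- Geometric radii make the series below satisfy the M-test.
  choose y hyc hfy using fun k : ℕ => hc ((1 / 2) ^ k) (by positivity)
  have hterm : ∀ k x, |(y k - c) * (A k).indicator (1 : ℝ → ℝ) x| ≤ (1 / 2) ^ k := by
    intro k x
    have hy : |y k - c| < (1 / 2) ^ k := hyc k
    by_cases hx : x ∈ A k
    · simpa [Set.indicator_of_mem hx] using hy.le
    · simp [Set.indicator_of_notMem hx]
  have hsum := IsBaireClass.tsum summable_geometric_two hterm fun k =>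
    (hA k).comp (F := fun z => (y k - c) * z) (by fun_prop)
  have hg := hsum.comp (F := fun z => c + z) (by fun_prop)
  -- The inner function is `y k` on `A k` and `c` off the union, so this is 1 on the union and 0
  -- elsewhere.
  have hfg := (hf _ hg).comp (F := fun z => min 1 (|z - f c| / ε)) (by fun_prop)
  convert hfg using 2 with x
  by_cases hx : x ∈ ⋃ k, A k
  · obtain ⟨k, hk⟩ := Set.mem_iUnion.1 hx
    have hts : ∑' i, (y i - c) * (A i).indicator (1 : ℝ → ℝ) x = y k - c := by
      rw [tsum_eq_single k fun i hi => ?_]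
      · simp [Set.indicator_of_mem hk]
      · rw [Set.indicator_of_notMem (Set.disjoint_right.1 (hd hi) hk), mul_zero]
    rw [Set.indicator_of_mem hx, hts, add_sub_cancel]
    exact (min_eq_left ((one_le_div hε).2 (hfy k))).symm
  · have hk : ∀ k, x ∉ A k := by simpa using hx
    simp [Set.indicator_of_notMem hx, Set.indicator_of_notMem (hk _)]

theorem continuous_of_comp_isBaireClass {n : ℕ} {f : ℝ → ℝ}
    (hf : ∀ g : ℝ → ℝ, IsBaireClass n g → IsBaireClass n fun x => f (g x)) : Continuous f := by
  cases n with
  | zero => exact hf id continuous_id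
  | succ n =>
    refine continuous_iff_continuousAt.2 fun c => ?_
    by_contra hc
    obtain ⟨A, hA, hnA⟩ := exists_measurableSet_not_isBaireClass_indicator (n + 1)
    refine hnA ?_
    clear hnA
    induction A, hA using MeasurableSpace.induction_on_inter
      (BorelSpace.measurable_eq.trans (borel_eq_generateFrom_Ioi ℝ)) isPiSystem_Ioi with
    | empty => simpa using IsBaireClass.of_continuous (X := ℝ) (continuous_const (y := (0 : ℝ))) (n + 1)
    | basic t ht =>
      obtain ⟨a, rfl⟩ := ht
      exact IsBaireClass.indicator_Ioi a n
    | compl t _ ih =>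
      convert ih.comp (F := fun z => 1 - z) (by fun_prop) using 2 with x
      by_cases hx : x ∈ t <;> simp [hx]
    | iUnion A hd _ ih => exact isBaireClass_indicator_iUnion hf hc hd ih

theorem mainTheorem4 (n : ℕ) (f : ℝ → ℝ)
    (hf : Set.MapsTo (leftCompOp f) (BaireSpaceOfClass n ℝ) (BaireSpaceOfClass n ℝ)) :
    Continuous (hf.restrict (leftCompOp f) (BaireSpaceOfClass n ℝ) (BaireSpaceOfClass n ℝ)) ∧
    ∀ (G : ℕ → ℝ → ℝ) (g : ℝ → ℝ),
      (∀ k, G k ∈ BaireSpaceOfClass n ℝ) → g ∈ BaireSpaceOfClass n ℝ →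
      (∀ x, Tendsto (fun k => G k x) atTop (𝓝 (g x))) →
      ∀ x, Tendsto (fun k => leftCompOp f (G k) x) atTop (𝓝 (leftCompOp f g x)) := by
  have hcont : Continuous f := continuous_of_comp_isBaireClass fun g hg => hf hg
  have hop : Continuous (leftCompOp f : (ℝ → ℝ) → ℝ → ℝ) :=
    continuous_pi fun x => hcont.comp (continuous_apply x)
  exact ⟨hop.restrict hf, fun G g _ _ h x => (hcont.tendsto _).comp (h x)⟩
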